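/- Let $\mathbb C$ be an exact category in the sense of Barr: $\mathbb C$ has finite limits, every morphism factors as a regular epimorphism followed by a monomorphism, regular epimorphisms are stable under pullback, and every internal equivalence relation is the kernel pair of some morphism. Let $\mathsf{PreOrd}(\mathbb C)$ be the category of internal preorders $(A,\rho)$ in $\mathbb C$, i.e. reflexive and transitive relations $\langle r_1,r_2\rangle\colon\rho\rightarrowtail A\times A$, a morphism $(A,\rho)\to(B,\sigma)$ being a pair $f\colon A\to B$, $\bar f\colon\rho\to\sigma$ commuting with the respective projections. For a preorder $(A,\rho)$ let $\sim_\rho\,=\rho\wedge\rho^\circ$ (an equivalence relation on $A$), and let $\mathsf{ParOrd}(\mathbb C)$ be the full subcategory of internal partial orders, i.e. of those $(A,\rho)$ for which $\sim_\rho$ is the diagonal $\Delta_A$. Let $F\colon\mathsf{PreOrd}(\mathbb C)\to\mathsf{ParOrd}(\mathbb C)$ be the left adjoint of the inclusion $U$, given by $F(A,\rho)=(A/{\sim_\rho},\pi_A(\rho))$, where $\pi_A\colon A\to A/{\sim_\rho}$ is the coequalizer of the projections of $\sim_\rho$ and $\pi_A(\rho)$ is the regular image of $\rho$ along $\pi_A$;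 the $(A,\rho)$-component of the unit is the canonical morphism $(\pi_A,\bar\pi_A)\colon(A,\rho)\to(A/{\sim_\rho},\pi_A(\rho))$, where $\bar\pi_A\colon\rho\to\pi_A(\rho)$ is the regular epimorphism of the image factorization. Then $F$ has stable units in the sense of Cassidy, Hébert and Kelly: for every preorder $(X,\rho)$ and every morphism $(f,\bar f)\colon(Z,\sigma)\to(X/{\sim_\rho},\pi_X(\rho))$ in $\mathsf{PreOrd}(\mathbb C)$, the functor $F$ sends every pullback square in $\mathsf{PreOrd}(\mathbb C)$ of $(\pi_X,\bar\pi_X)$ and $(f,\bar f)$ to a pullback square in $\mathsf{ParOrd}(\mathbb C)$. Consequently $F\dashv U$ is an admissible categorical Galois structure with respect to the classes of all morphisms: $\mathsf{PreOrd}(\mathbb C)$ and $\mathsf{ParOrd}(\mathbb C)$ have pullbacks, and for every $\mathbf X\in\mathsf{PreOrd}(\mathbb C)$ the functor $\mathsf{ParOrd}(\mathbb C)/F(\mathbf X)\to\mathsf{PreOrd}(\mathbb C)/\mathbf X$, which applies $U$ and then pulls back along the unit component $\mathbf X\to UF(\mathbf X)$, is fully faithful. -/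

import Mathlib

open CategoryTheory CategoryTheory.Limits

universe v u v₁ v₂ u₁ u₂

/-- A (Barr-)exact category: a regular category (finite limits, coequalizers of kernel pairs, which
amounts to (regular epi, mono)-factorizations, and pullback-stable regular epimorphisms) in which
every internal equivalence relation is effective, i.e. is the kernel pair of some arrow. -/
class BarrExact (C : Type u) [Category.{v} C] : Prop extends Regular C where
  effective : ∀ {R X : C} (p₁ p₂ : R ⟶ X), IsEquivalenceRelation p₁ p₂ →
    ∃ (Y : C) (f : X ⟶ Y), IsKernelPair f p₁ p₂

/-- An internal preorder `(A, ρ)` in `C`: a relation (jointly monic pair) `r₁, r₂ : ρ ⟶ A` that is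
reflexive and transitive. -/
structure PreOrd (C : Type u) [Category.{v} C] where
  /-- the object `A` -/
  carrier : C
  /-- the object `ρ` -/
  rel : C
  /-- first projection -/
  r₁ : rel ⟶ carrier
  /-- second projection -/
  r₂ : rel ⟶ carrier
  refl' : Nonempty (ReflexiveRelation r₁ r₂)
  trans' : Nonempty (TransitiveRelation r₁ r₂)

namespace PreOrd

section Basic

attribute [local simp] prod.lift_fst prod.lift_snd prod.lift_fst_assoc prod.lift_snd_assoc
  pullback.lift_fst pullback.lift_snd pullback.lift_fst_assoc pullback.lift_snd_assoc

variable {C : Type u} [Category.{v} C]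

/-- A morphism `(A, ρ) ⟶ (B, σ)` of internal preorders: a pair `(f, f̄)` compatible with both
projections. -/
@[ext]
structure Hom (X Y : PreOrd C) where
  /-- the arrow `f : A ⟶ B` -/
  base : X.carrier ⟶ Y.carrier
  /-- the arrow `f̄ : ρ ⟶ σ` -/
  onRel : X.rel ⟶ Y.rel
  w₁ : onRel ≫ Y.r₁ = X.r₁ ≫ base
  w₂ : onRel ≫ Y.r₂ = X.r₂ ≫ base

instance : Category (PreOrd C) where
  Hom := Hom
  id X := ⟨𝟙 _, 𝟙 _, by simp, by simp⟩
  comp f g := ⟨f.base ≫ g.base, f.onRel ≫ g.onRel,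
    by rw [Category.assoc, g.w₁, ← Category.assoc, f.w₁, Category.assoc],
    by rw [Category.assoc, g.w₂, ← Category.assoc, f.w₂, Category.assoc]⟩
  id_comp f := Hom.ext (Category.id_comp _) (Category.id_comp _)
  comp_id f := Hom.ext (Category.comp_id _) (Category.comp_id _)
  assoc f g h := Hom.ext (Category.assoc _ _ _) (Category.assoc _ _ _)

@[simp] theorem id_base (X : PreOrd C) : Hom.base (𝟙 X) = 𝟙 X.carrier := rfl
@[simp] theorem id_onRel (X : PreOrd C) : Hom.onRel (𝟙 X) = 𝟙 X.rel := rfl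
@[simp] theorem comp_base {X Y Z : PreOrd C} (f : X ⟶ Y) (g : Y ⟶ Z) :
    (f ≫ g).base = f.base ≫ g.base := rfl
@[simp] theorem comp_onRel {X Y Z : PreOrd C} (f : X ⟶ Y) (g : Y ⟶ Z) :
    (f ≫ g).onRel = f.onRel ≫ g.onRel := rfl

theorem rel_ext (X : PreOrd C) {T : C} (a b : T ⟶ X.rel) (h₁ : a ≫ X.r₁ = b ≫ X.r₁)
    (h₂ : a ≫ X.r₂ = b ≫ X.r₂) : a = b :=
  X.refl'.some.right_cancellation a b h₁ h₂

theorem hom_ext {X Y : PreOrd C} {f g : X ⟶ Y} (h : f.base = g.base) : f = g :=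
  Hom.ext h (Y.rel_ext _ _ (by rw [f.w₁, g.w₁, h]) (by rw [f.w₂, g.w₂, h]))

/-- `X.Le a b`: the generalized elements `a, b` of `A` are related by `ρ`. -/
def Le (X : PreOrd C) {T : C} (a b : T ⟶ X.carrier) : Prop :=
  ∃ h : T ⟶ X.rel, h ≫ X.r₁ = a ∧ h ≫ X.r₂ = b

theorem Le.refl (X : PreOrd C) {T : C} (a : T ⟶ X.carrier) : X.Le a a :=
  ⟨a ≫ X.refl'.some.r, by simp, by simp⟩

theorem Le.trans {X : PreOrd C} {T : C} {a b c : T ⟶ X.carrier} (h : X.Le a b) (h' : X.Le b c) :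
    X.Le a c := by
  obtain ⟨x, rfl, rfl⟩ := h
  obtain ⟨y, hy, rfl⟩ := h'
  let t := X.trans'.some
  let l := PullbackCone.IsLimit.lift t.isLimit x y hy.symm
  have l₁ : l ≫ t.c.fst = x := PullbackCone.IsLimit.lift_fst _ _ _ _
  have l₂ : l ≫ t.c.snd = y := PullbackCone.IsLimit.lift_snd _ _ _ _
  refine ⟨l ≫ t.t, ?_, ?_⟩
  · rw [Category.assoc, t.transitivity₁, ← Category.assoc, l₁]
  · rw [Category.assoc, t.transitivity₂, ← Category.assoc, l₂]

theorem Le.precomp {X : PreOrd C} {S T : C} {a b : T ⟶ X.carrier} (h : X.Le a b) (s : S ⟶ T) :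
    X.Le (s ≫ a) (s ≫ b) := by
  obtain ⟨x, rfl, rfl⟩ := h
  exact ⟨s ≫ x, by simp, by simp⟩

theorem Le.map {X Y : PreOrd C} {T : C} {a b : T ⟶ X.carrier} (h : X.Le a b) (f : X ⟶ Y) :
    Y.Le (a ≫ f.base) (b ≫ f.base) := by
  obtain ⟨x, rfl, rfl⟩ := h
  exact ⟨x ≫ f.onRel, by simp [f.w₁], by simp [f.w₂]⟩

/-- A morphism of preorders from an order-preserving arrow of `C`. -/
noncomputable def homOfLe {X Y : PreOrd C} (f : X.carrier ⟶ Y.carrier)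
    (h : Y.Le (X.r₁ ≫ f) (X.r₂ ≫ f)) : X ⟶ Y where
  base := f
  onRel := h.choose
  w₁ := h.choose_spec.1
  w₂ := h.choose_spec.2

variable [HasFiniteLimits C]

instance mono_lift (X : PreOrd C) : Mono (prod.lift X.r₁ X.r₂) where
  right_cancellation a b h := by
    apply X.rel_ext
    · simpa using congrArg (· ≫ prod.fst) h
    · simpa using congrArg (· ≫ prod.snd) h

/-- A preorder relation is local with respect to covers by regular epimorphisms. -/
theorem Le.descend {X : PreOrd C} {S T : C} (e : S ⟶ T) [IsRegularEpi e] {a b : T ⟶ X.carrier}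
    (h : X.Le (e ≫ a) (e ≫ b)) : X.Le a b := by
  obtain ⟨x, h₁, h₂⟩ := h
  have sq : CommSq x e (prod.lift X.r₁ X.r₂) (prod.lift a b) :=
    ⟨by ext <;> simp [h₁, h₂]⟩
  refine ⟨sq.lift, ?_, ?_⟩
  · simpa using congrArg (· ≫ prod.fst) sq.fac_right
  · simpa using congrArg (· ≫ prod.snd) sq.fac_right

/-- The object of the relation `∼ρ = ρ ∧ ρ°`, the intersection of `⟨r₁, r₂⟩` and `⟨r₂, r₁⟩`. -/
noncomputable def sim (X : PreOrd C) : C := pullback (prod.lift X.r₁ X.r₂) (prod.lift X.r₂ X.r₁)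

/-- The inclusion `∼ρ ⟶ ρ`. -/
noncomputable def simIncl (X : PreOrd C) : X.sim ⟶ X.rel :=
  pullback.fst (prod.lift X.r₁ X.r₂) (prod.lift X.r₂ X.r₁)

/-- The inclusion `∼ρ ⟶ ρ°`. -/
noncomputable def simInclOp (X : PreOrd C) : X.sim ⟶ X.rel :=
  pullback.snd (prod.lift X.r₁ X.r₂) (prod.lift X.r₂ X.r₁)

theorem sim_condition (X : PreOrd C) :
    X.simIncl ≫ prod.lift X.r₁ X.r₂ = X.simInclOp ≫ prod.lift X.r₂ X.r₁ :=
  pullback.condition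

/-- First projection of `∼ρ`. -/
noncomputable def simFst (X : PreOrd C) : X.sim ⟶ X.carrier := X.simIncl ≫ X.r₁

/-- Second projection of `∼ρ`. -/
noncomputable def simSnd (X : PreOrd C) : X.sim ⟶ X.carrier := X.simIncl ≫ X.r₂

theorem simInclOp_r₁ (X : PreOrd C) : X.simInclOp ≫ X.r₁ = X.simSnd := by
  simpa [simSnd] using (congrArg (· ≫ prod.snd) X.sim_condition).symm

theorem simInclOp_r₂ (X : PreOrd C) : X.simInclOp ≫ X.r₂ = X.simFst := by
  simpa [simFst] using (congrArg (· ≫ prod.fst) X.sim_condition).symm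

theorem sim_le (X : PreOrd C) : X.Le X.simFst X.simSnd := ⟨X.simIncl, rfl, rfl⟩

theorem sim_ge (X : PreOrd C) : X.Le X.simSnd X.simFst :=
  ⟨X.simInclOp, X.simInclOp_r₁, X.simInclOp_r₂⟩

theorem exists_sim (X : PreOrd C) {T : C} {a b : T ⟶ X.carrier} (h : X.Le a b) (h' : X.Le b a) :
    ∃ t : T ⟶ X.sim, t ≫ X.simFst = a ∧ t ≫ X.simSnd = b := by
  obtain ⟨x, rfl, rfl⟩ := h
  obtain ⟨y, h₁, h₂⟩ := h'
  obtain ⟨t, ht⟩ : ∃ t : T ⟶ X.sim, t ≫ X.simIncl = x :=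
    ⟨pullback.lift x y (by ext <;> simp [h₁, h₂]), pullback.lift_fst _ _ _⟩
  exact ⟨t, by rw [simFst, reassoc_of% ht], by rw [simSnd, reassoc_of% ht]⟩

theorem sim_ext (X : PreOrd C) {T : C} (a b : T ⟶ X.sim) (h₁ : a ≫ X.simFst = b ≫ X.simFst)
    (h₂ : a ≫ X.simSnd = b ≫ X.simSnd) : a = b := by
  refine pullback.hom_ext (X.rel_ext (a ≫ X.simIncl) (b ≫ X.simIncl) ?_ ?_)
    (X.rel_ext (a ≫ X.simInclOp) (b ≫ X.simInclOp) ?_ ?_)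
  · simpa [simFst] using h₁
  · simpa [simSnd] using h₂
  · rw [Category.assoc, Category.assoc, simInclOp_r₁, h₂]
  · rw [Category.assoc, Category.assoc, simInclOp_r₂, h₁]

/-- `∼ρ` is an internal equivalence relation. -/
theorem isEquivalenceRelation_sim (X : PreOrd C) : IsEquivalenceRelation X.simFst X.simSnd := by
  obtain ⟨r, hr₁, hr₂⟩ := X.exists_sim (Le.refl X (𝟙 _)) (Le.refl X (𝟙 _))
  obtain ⟨s, hs₁, hs₂⟩ := X.exists_sim X.sim_ge X.sim_le
  have hc : pullback.fst X.simSnd X.simFst ≫ X.simSnd =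
      pullback.snd X.simSnd X.simFst ≫ X.simFst := pullback.condition
  have h₁ := (X.sim_le.precomp (pullback.fst X.simSnd X.simFst))
  have h₁' := (X.sim_ge.precomp (pullback.fst X.simSnd X.simFst))
  rw [hc] at h₁ h₁'
  obtain ⟨t, ht₁, ht₂⟩ := X.exists_sim
    (h₁.trans (X.sim_le.precomp (pullback.snd X.simSnd X.simFst)))
    ((X.sim_ge.precomp (pullback.snd X.simSnd X.simFst)).trans h₁')
  exact ⟨⟨
    { right_cancellation := fun _ a b h h' => X.sim_ext a b h h'
      r := r
      reflexivity₁ := hr₁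
      reflexivity₂ := hr₂
      s := s
      symmetry₁ := hs₁
      symmetry₂ := hs₂
      c := pullback.cone X.simSnd X.simFst
      isLimit := pullback.isLimit X.simSnd X.simFst
      t := t
      transitivity₁ := ht₁
      transitivity₂ := ht₂ }⟩⟩

/-- A preorder is antisymmetric when `∼ρ` is the discrete relation `Δ`, i.e. coincides, as a
subobject of `A × A`, with the diagonal. -/
def IsAntisymmetric (X : PreOrd C) : Prop :=
  ∃ e : X.sim ≅ X.carrier, e.hom ≫ diag X.carrier = prod.lift X.simFst X.simSnd

theorem isAntisymmetric_of_le (X : PreOrd C)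
    (h : ∀ ⦃T : C⦄ (a b : T ⟶ X.carrier), X.Le a b → X.Le b a → a = b) : X.IsAntisymmetric := by
  have h' := h _ _ X.sim_le X.sim_ge
  obtain ⟨r, hr₁, hr₂⟩ := X.exists_sim (Le.refl X (𝟙 _)) (Le.refl X (𝟙 _))
  refine ⟨⟨X.simFst, r, X.sim_ext _ _ ?_ ?_, hr₁⟩, ?_⟩
  · simp [hr₁]
  · simp [hr₂, h']
  · ext <;> simp [h']

theorem IsAntisymmetric.eq_of_le {X : PreOrd C} (h : X.IsAntisymmetric) {T : C}
    {a b : T ⟶ X.carrier} (h₁ : X.Le a b) (h₂ : X.Le b a) : a = b := by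
  obtain ⟨e, he⟩ := h
  obtain ⟨t, rfl, rfl⟩ := X.exists_sim h₁ h₂
  have e₁ : e.hom = X.simFst := by simpa using congrArg (· ≫ prod.fst) he
  have e₂ : e.hom = X.simSnd := by simpa using congrArg (· ≫ prod.snd) he
  rw [← e₁, ← e₂]

end Basic

section Reflector

attribute [local simp] prod.lift_fst prod.lift_snd prod.lift_fst_assoc prod.lift_snd_assoc

variable {C : Type u} [Category.{v} C] [BarrExact C]

instance hasCoequalizer_sim (X : PreOrd C) : HasCoequalizer X.simFst X.simSnd := by
  obtain ⟨Y, f, h⟩ := BarrExact.effective _ _ X.isEquivalenceRelation_sim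
  exact Regular.hasCoequalizer_of_isKernelPair h

/-- The quotient object `A / ∼ρ`. -/
noncomputable def quotObj (X : PreOrd C) : C := coequalizer X.simFst X.simSnd

/-- The canonical quotient `π : A ⟶ A / ∼ρ`. -/
noncomputable def quotπ (X : PreOrd C) : X.carrier ⟶ X.quotObj :=
  coequalizer.π X.simFst X.simSnd

instance isRegularEpi_quotπ (X : PreOrd C) : IsRegularEpi X.quotπ :=
  inferInstanceAs (IsRegularEpi (coequalizer.π X.simFst X.simSnd))

theorem simFst_quotπ (X : PreOrd C) : X.simFst ≫ X.quotπ = X.simSnd ≫ X.quotπ :=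
  coequalizer.condition _ _

/-- The (regular epi, mono)-factorization of `ρ ⟶ A × A ⟶ (A / ∼ρ) × (A / ∼ρ)`. -/
noncomputable def imageFact (X : PreOrd C) :
    StrongEpiMonoFactorisation (prod.lift (X.r₁ ≫ X.quotπ) (X.r₂ ≫ X.quotπ)) :=
  Regular.strongEpiMonoFactorisation _

/-- The object `π(ρ)`, the regular image of `ρ` along `π`. -/
noncomputable def quotRel (X : PreOrd C) : C := X.imageFact.I

/-- The regular epimorphism `π̄ : ρ ⟶ π(ρ)`. -/
noncomputable def quotπRel (X : PreOrd C) : X.rel ⟶ X.quotRel := X.imageFact.e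

instance isRegularEpi_quotπRel (X : PreOrd C) : IsRegularEpi X.quotπRel :=
  inferInstanceAs (IsRegularEpi (Regular.strongEpiMonoFactorisation
    (prod.lift (X.r₁ ≫ X.quotπ) (X.r₂ ≫ X.quotπ))).e)

/-- The mono `π(ρ) ⟶ (A / ∼ρ) × (A / ∼ρ)`. -/
noncomputable def quotIncl (X : PreOrd C) : X.quotRel ⟶ X.quotObj ⨯ X.quotObj := X.imageFact.m

instance mono_quotIncl (X : PreOrd C) : Mono X.quotIncl := X.imageFact.m_mono

/-- First projection of `π(ρ)`. -/
noncomputable def quotFst (X : PreOrd C) : X.quotRel ⟶ X.quotObj := X.quotIncl ≫ prod.fst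

/-- Second projection of `π(ρ)`. -/
noncomputable def quotSnd (X : PreOrd C) : X.quotRel ⟶ X.quotObj := X.quotIncl ≫ prod.snd

theorem quotπRel_fst (X : PreOrd C) : X.quotπRel ≫ X.quotFst = X.r₁ ≫ X.quotπ := by
  have h := congrArg (· ≫ prod.fst) X.imageFact.fac
  simp only [Category.assoc, prod.lift_fst] at h
  exact h

theorem quotπRel_snd (X : PreOrd C) : X.quotπRel ≫ X.quotSnd = X.r₂ ≫ X.quotπ := by
  have h := congrArg (· ≫ prod.snd) X.imageFact.fac
  simp only [Category.assoc, prod.lift_snd] at h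
  exact h

instance jointlyMono_quot (X : PreOrd C) : JointlyMono₂ X.quotFst X.quotSnd where
  right_cancellation Y a b h₁ h₂ := by
    rw [← cancel_mono X.quotIncl]
    ext
    · exact (Category.assoc _ _ _).trans (h₁.trans (Category.assoc _ _ _).symm)
    · exact (Category.assoc _ _ _).trans (h₂.trans (Category.assoc _ _ _).symm)

theorem isKernelPair_quotπ (X : PreOrd C) : IsKernelPair X.quotπ X.simFst X.simSnd := by
  obtain ⟨Y, f, h⟩ := BarrExact.effective _ _ X.isEquivalenceRelation_sim
  have hf : X.quotπ ≫ coequalizer.desc f h.w = f := coequalizer.π_desc _ _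
  exact IsKernelPair.cancel_right (f₂ := coequalizer.desc f h.w) X.simFst_quotπ (hf.symm ▸ h)

/-- Generalized elements identified by `π` are related by `ρ`. -/
theorem le_of_quotπ_eq (X : PreOrd C) {T : C} {a b : T ⟶ X.carrier}
    (h : a ≫ X.quotπ = b ≫ X.quotπ) : X.Le a b := by
  have := X.sim_le.precomp (X.isKernelPair_quotπ.lift a b h)
  rwa [IsKernelPair.lift_fst, IsKernelPair.lift_snd] at this

/-- `ρ` is the inverse image of `π(ρ)` along `π`. -/
theorem le_of_quot (X : PreOrd C) {T : C} {a b : T ⟶ X.carrier} (t : T ⟶ X.quotRel)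
    (h₁ : t ≫ X.quotFst = a ≫ X.quotπ) (h₂ : t ≫ X.quotSnd = b ≫ X.quotπ) : X.Le a b := by
  have hc := pullback.condition (f := X.quotπRel) (g := t)
  apply Le.descend (pullback.snd X.quotπRel t)
  have hl : X.Le (pullback.fst X.quotπRel t ≫ X.r₁) (pullback.fst X.quotπRel t ≫ X.r₂) :=
    ⟨_, rfl, rfl⟩
  refine (X.le_of_quotπ_eq ?_).trans (hl.trans (X.le_of_quotπ_eq ?_))
  · rw [Category.assoc, ← h₁, ← Category.assoc, ← hc, Category.assoc, quotπRel_fst, Category.assoc]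
  · rw [Category.assoc, Category.assoc, ← h₂, ← quotπRel_snd, ← Category.assoc, hc,
      Category.assoc]

/-- Lifting a map along a strong epimorphism into `π(ρ)`. -/
theorem quot_descend (X : PreOrd C) {S T : C} (e : S ⟶ T) [IsRegularEpi e] (a b : T ⟶ X.quotObj)
    (x : S ⟶ X.quotRel) (h₁ : x ≫ X.quotFst = e ≫ a) (h₂ : x ≫ X.quotSnd = e ≫ b) :
    ∃ t : T ⟶ X.quotRel, t ≫ X.quotFst = a ∧ t ≫ X.quotSnd = b := by
  have sq : CommSq x e X.quotIncl (prod.lift a b) := ⟨by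
    ext
    · rw [Category.assoc, Category.assoc, prod.lift_fst]; exact h₁
    · rw [Category.assoc, Category.assoc, prod.lift_snd]; exact h₂⟩
  refine ⟨sq.lift, ?_, ?_⟩
  · rw [quotFst, ← Category.assoc, sq.fac_right, prod.lift_fst]
  · rw [quotSnd, ← Category.assoc, sq.fac_right, prod.lift_snd]

/-- The preorder `(A / ∼ρ, π(ρ))`. -/
noncomputable def quot (X : PreOrd C) : PreOrd C where
  carrier := X.quotObj
  rel := X.quotRel
  r₁ := X.quotFst
  r₂ := X.quotSnd
  refl' := by
    obtain ⟨h, h₁, h₂⟩ := Le.refl X (𝟙 _)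
    obtain ⟨t, ht₁, ht₂⟩ := X.quot_descend X.quotπ (𝟙 _) (𝟙 _) (h ≫ X.quotπRel)
      (by rw [Category.assoc, quotπRel_fst, ← Category.assoc, h₁]; simp)
      (by rw [Category.assoc, quotπRel_snd, ← Category.assoc, h₂]; simp)
    exact ⟨{ toJointlyMono₂ := X.jointlyMono_quot, r := t, reflexivity₁ := ht₁,
             reflexivity₂ := ht₂ }⟩
  trans' := by
    -- cover the object of composable pairs by pairs of `ρ` that become composable under `π`
    let P := pullback X.quotSnd X.quotFst
    let u : P ⟶ X.quotRel := pullback.fst X.quotSnd X.quotFst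
    let w : P ⟶ X.quotRel := pullback.snd X.quotSnd X.quotFst
    have huw : u ≫ X.quotSnd = w ≫ X.quotFst := pullback.condition
    let e₁ : pullback X.quotπRel u ⟶ P := pullback.snd _ _
    let x : pullback X.quotπRel u ⟶ X.rel := pullback.fst _ _
    have hx : x ≫ X.quotπRel = e₁ ≫ u := pullback.condition
    let e₂ : pullback X.quotπRel (e₁ ≫ w) ⟶ pullback X.quotπRel u := pullback.snd _ _
    let y : pullback X.quotπRel (e₁ ≫ w) ⟶ X.rel := pullback.fst _ _
    have hy : y ≫ X.quotπRel = e₂ ≫ e₁ ≫ w := pullback.condition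
    have h₁ : X.Le (e₂ ≫ x ≫ X.r₁) (e₂ ≫ x ≫ X.r₂) := ⟨e₂ ≫ x, by simp, by simp⟩
    have h₂ : X.Le (e₂ ≫ x ≫ X.r₂) (y ≫ X.r₁) := X.le_of_quotπ_eq (by
      rw [Category.assoc, Category.assoc, Category.assoc, ← quotπRel_fst, ← quotπRel_snd,
        reassoc_of% hx, reassoc_of% hy, huw])
    have h₃ : X.Le (y ≫ X.r₁) (y ≫ X.r₂) := ⟨y, rfl, rfl⟩
    obtain ⟨z, hz₁, hz₂⟩ := h₁.trans (h₂.trans h₃)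
    obtain ⟨t', ht₁', ht₂'⟩ := X.quot_descend e₂ (e₁ ≫ u ≫ X.quotFst) (e₁ ≫ w ≫ X.quotSnd)
      (z ≫ X.quotπRel)
      (by rw [Category.assoc, quotπRel_fst, reassoc_of% hz₁, ← quotπRel_fst, reassoc_of% hx])
      (by rw [Category.assoc, quotπRel_snd, reassoc_of% hz₂, ← quotπRel_snd, reassoc_of% hy])
    obtain ⟨t, ht₁, ht₂⟩ := X.quot_descend e₁ (u ≫ X.quotFst) (w ≫ X.quotSnd) t' ht₁' ht₂'
    exact ⟨{ toJointlyMono₂ := X.jointlyMono_quot, c := pullback.cone X.quotSnd X.quotFst,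
             isLimit := pullback.isLimit _ _, t := t, transitivity₁ := ht₁,
             transitivity₂ := ht₂ }⟩

/-- The canonical quotient morphism `(π, π̄) : (A, ρ) ⟶ (A / ∼ρ, π(ρ))`. -/
noncomputable def quotHom (X : PreOrd C) : X ⟶ X.quot where
  base := X.quotπ
  onRel := X.quotπRel
  w₁ := X.quotπRel_fst
  w₂ := X.quotπRel_snd

theorem isAntisymmetric_quot (X : PreOrd C) : X.quot.IsAntisymmetric := by
  apply isAntisymmetric_of_le
  rintro T a b ⟨s, hs₁, hs₂⟩ ⟨t, ht₁, ht₂⟩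
  change T ⟶ X.quotRel at s t
  change T ⟶ X.quotObj at a b
  replace hs₁ : s ≫ X.quotFst = a := hs₁
  replace hs₂ : s ≫ X.quotSnd = b := hs₂
  replace ht₁ : t ≫ X.quotFst = b := ht₁
  replace ht₂ : t ≫ X.quotSnd = a := ht₂
  let e : pullback X.quotπRel s ⟶ T := pullback.snd _ _
  let x : pullback X.quotπRel s ⟶ X.rel := pullback.fst _ _
  have hx : x ≫ X.quotπRel = e ≫ s := pullback.condition
  have hxa : x ≫ X.r₁ ≫ X.quotπ = e ≫ a := by
    rw [← quotπRel_fst, reassoc_of% hx, hs₁]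
  have hxb : x ≫ X.r₂ ≫ X.quotπ = e ≫ b := by
    rw [← quotπRel_snd, reassoc_of% hx, hs₂]
  obtain ⟨z, hz₁, hz₂⟩ := X.exists_sim (a := x ≫ X.r₁) (b := x ≫ X.r₂) ⟨x, rfl, rfl⟩
    (X.le_of_quot (e ≫ t) (by rw [Category.assoc, ht₁, Category.assoc, hxb])
      (by rw [Category.assoc, ht₂, Category.assoc, hxa]))
  refine (cancel_epi e).1 ?_
  rw [← hxa, ← hxb, ← reassoc_of% hz₁, ← reassoc_of% hz₂, X.simFst_quotπ]

end Reflector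

end PreOrd

/-- The category of internal partial orders in `C`: the full subcategory of `PreOrd C` on the
antisymmetric preorders. -/
abbrev ParOrd (C : Type u) [Category.{v} C] [HasFiniteLimits C] :=
  ObjectProperty.FullSubcategory (fun X : PreOrd C => X.IsAntisymmetric)

namespace ParOrd

/-- The inclusion `U : ParOrd(C) ⥤ PreOrd(C)`. -/
abbrev incl (C : Type u) [Category.{v} C] [HasFiniteLimits C] : ParOrd C ⥤ PreOrd C :=
  ObjectProperty.ι _

variable {C : Type u} [Category.{v} C] [BarrExact C]

/-- The partial order `F(A, ρ) = (A / ∼ρ, π(ρ))`. -/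
noncomputable def ofPreOrd (X : PreOrd C) : ParOrd C := ⟨X.quot, X.isAntisymmetric_quot⟩

theorem exists_desc (X : PreOrd C) (Y : ParOrd C) (f : X ⟶ Y.obj) :
    ∃ g : X.quot ⟶ Y.obj, X.quotHom ≫ g = f := by
  have hf : X.simFst ≫ f.base = X.simSnd ≫ f.base :=
    Y.property.eq_of_le (X.sim_le.map f) (X.sim_ge.map f)
  obtain ⟨g, hg⟩ : ∃ g : X.quotObj ⟶ Y.obj.carrier, X.quotπ ≫ g = f.base :=
    ⟨coequalizer.desc f.base hf, coequalizer.π_desc _ _⟩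
  have hle : Y.obj.Le (X.quotFst ≫ g) (X.quotSnd ≫ g) := by
    apply PreOrd.Le.descend X.quotπRel
    refine ⟨f.onRel, ?_, ?_⟩
    · rw [f.w₁, ← hg, ← Category.assoc, ← Category.assoc, X.quotπRel_fst]
    · rw [f.w₂, ← hg, ← Category.assoc, ← Category.assoc, X.quotπRel_snd]
  exact ⟨PreOrd.homOfLe (X := X.quot) g hle, PreOrd.hom_ext hg⟩

/-- The universal property of the quotient: morphisms `F(X) ⟶ Y` in `ParOrd C` correspond to
morphisms `X ⟶ Y` in `PreOrd C` by composition with `(π, π̄)`. -/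
noncomputable def homEquiv (X : PreOrd C) (Y : ParOrd C) :
    (ofPreOrd X ⟶ Y) ≃ (X ⟶ (incl C).obj Y) :=
  Equiv.ofBijective (fun g => X.quotHom ≫ g.hom) (by
    constructor
    · intro g g' h
      apply ObjectProperty.hom_ext
      apply PreOrd.hom_ext
      have h' : X.quotπ ≫ g.hom.base = X.quotπ ≫ g'.hom.base := congrArg PreOrd.Hom.base h
      exact (cancel_epi X.quotπ).1 h'
    · intro f
      obtain ⟨g, hg⟩ := exists_desc X Y f
      exact ⟨ObjectProperty.homMk g, hg⟩)

variable (C)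

/-- The reflector `F : PreOrd(C) ⥤ ParOrd(C)`, `F(A, ρ) = (A / ∼ρ, π(ρ))`; on a morphism `f` it is
the unique morphism with `(π, π̄) ≫ F(f) = f ≫ (π, π̄)`. -/
noncomputable def reflector : PreOrd C ⥤ ParOrd C :=
  Adjunction.leftAdjointOfEquiv (G := incl C) homEquiv
    (fun X _ _ g h => (Category.assoc X.quotHom h.hom g.hom).symm)

/-- The adjunction `F ⊣ U`. -/
noncomputable def reflectorAdj : reflector C ⊣ incl C :=
  Adjunction.adjunctionOfEquivLeft (G := incl C) homEquiv
    (fun X _ _ g h => (Category.assoc X.quotHom h.hom g.hom).symm)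

/-- The unit of `F ⊣ U` is the canonical quotient. -/
theorem reflectorAdj_unit_app (X : PreOrd C) : (reflectorAdj C).unit.app X = X.quotHom :=
  Category.comp_id X.quotHom

end ParOrd

section Galois

variable {B : Type u₁} [Category.{v₁} B] {A : Type u₂} [Category.{v₂} A]
  {F : B ⥤ A} {V : A ⥤ B}

/-- The left adjoint `F` (the reflector, when `V` is fully faithful) has stable units (Cassidy,
Hébert, Kelly): it preserves every pullback of a component `η_X : X ⟶ V F X` of the unit along an
arbitrary morphism `f : Z ⟶ V F X`. -/
def HasStableUnits (adj : F ⊣ V) : Prop :=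
  ∀ ⦃X P Z : B⦄ (p₁ : P ⟶ X) (p₂ : P ⟶ Z) (f : Z ⟶ V.obj (F.obj X)),
    IsPullback p₁ p₂ (adj.unit.app X) f →
      IsPullback (F.map p₁) (F.map p₂) (F.map (adj.unit.app X)) (F.map f)

/-- For an adjunction `F ⊣ V`, the functor `V^X : A / F(X) ⥤ B / X` applying `V` and then
pulling back along the unit `η_X`; it is right adjoint to the functor induced by `F`. -/
noncomputable def sliceRightAdjoint [HasPullbacks B] (adj : F ⊣ V) (X : B) :
    Over (F.obj X) ⥤ Over X :=
  Over.post V ⋙ Over.pullback (adj.unit.app X)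

/-- The adjunction `F ⊣ V` is an admissible categorical Galois structure (Janelidze), with respect
to the classes of all morphisms of both categories: both categories have pullbacks, and every
functor `V^X : A / F(X) ⥤ B / X` is fully faithful. -/
def IsAdmissibleGaloisStructure (adj : F ⊣ V) : Prop :=
  ∃ (_ : HasPullbacks B) (_ : HasPullbacks A), ∀ X : B,
    (sliceRightAdjoint adj X).Full ∧ (sliceRightAdjoint adj X).Faithful

end Galois

/-! ### Componentwise pullbacks of internal preorders. -/

namespace PreOrd

section Pullback

variable {C : Type u} [Category.{v} C]

/-! The unit `quotHom` is a regular epimorphism on carriers that also reflects the order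
(`le_of_quot`). Both properties survive pullback, because pullbacks of preorders are componentwise
(`isPullback_pullbackObj`). Along a morphism with these two properties, every map to a partial order
extends uniquely: elements with the same image are related both ways, so antisymmetry identifies
their values (`exists_extension`). The reflector therefore inverts such a morphism
(`isIso_reflector_map`), and in particular every pullback of a unit component. The rest is formal.
The reflector also inverts the unit itself, so the image square has two parallel invertible sides
and is a pullback. On slices, the counit of the induced adjunction is the reflection of a pullback
of the unit followed by the original counit. It is invertible, so the right adjoint is fully
faithful. -/

theorem epi_of_epi_base {X Y : PreOrd C} (f : X ⟶ Y) [Epi f.base] : Epi f where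
  left_cancellation _ _ h := hom_ext ((cancel_epi f.base).1 (congrArg Hom.base h))

variable [HasFiniteLimits C]

section

variable {X Y Z : PreOrd C} (f : X ⟶ Z) (g : Y ⟶ Z)

/-- First projection of the relation on the pullback of internal preorders. -/
noncomputable def pullbackR₁ : pullback f.onRel g.onRel ⟶ pullback f.base g.base :=
  pullback.map _ _ _ _ X.r₁ Y.r₁ Z.r₁ f.w₁ g.w₁

/-- Second projection of the relation on the pullback of internal preorders. -/
noncomputable def pullbackR₂ : pullback f.onRel g.onRel ⟶ pullback f.base g.base :=
  pullback.map _ _ _ _ X.r₂ Y.r₂ Z.r₂ f.w₂ g.w₂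

theorem pullbackR₁_fst :
    pullbackR₁ f g ≫ pullback.fst _ _ = pullback.fst _ _ ≫ X.r₁ := pullback.lift_fst _ _ _

theorem pullbackR₁_snd :
    pullbackR₁ f g ≫ pullback.snd _ _ = pullback.snd _ _ ≫ Y.r₁ := pullback.lift_snd _ _ _

theorem pullbackR₂_fst :
    pullbackR₂ f g ≫ pullback.fst _ _ = pullback.fst _ _ ≫ X.r₂ := pullback.lift_fst _ _ _

theorem pullbackR₂_snd :
    pullbackR₂ f g ≫ pullback.snd _ _ = pullback.snd _ _ ≫ Y.r₂ := pullback.lift_snd _ _ _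

theorem jointlyMono_pullback : JointlyMono₂ (pullbackR₁ f g) (pullbackR₂ f g) where
  right_cancellation T a b h₁ h₂ := by
    refine pullback.hom_ext (X.rel_ext _ _ ?_ ?_) (Y.rel_ext _ _ ?_ ?_)
    · simpa [pullbackR₁_fst] using congrArg (· ≫ pullback.fst _ _) h₁
    · simpa [pullbackR₂_fst] using congrArg (· ≫ pullback.fst _ _) h₂
    · simpa [pullbackR₁_snd] using congrArg (· ≫ pullback.snd _ _) h₁
    · simpa [pullbackR₂_snd] using congrArg (· ≫ pullback.snd _ _) h₂

/-- A pair of generalized elements of the pullback is related as soon as both pairs of components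
are. -/
theorem exists_pullbackRel {T : C} {a b : T ⟶ pullback f.base g.base}
    (h : X.Le (a ≫ pullback.fst _ _) (b ≫ pullback.fst _ _))
    (h' : Y.Le (a ≫ pullback.snd _ _) (b ≫ pullback.snd _ _)) :
    ∃ t : T ⟶ pullback f.onRel g.onRel, t ≫ pullbackR₁ f g = a ∧ t ≫ pullbackR₂ f g = b := by
  obtain ⟨x, hx₁, hx₂⟩ := h
  obtain ⟨y, hy₁, hy₂⟩ := h'
  -- The two witnesses agree over `Z` because its projections are jointly monic and the endpoints
  -- already agree over `Z.carrier`.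
  have hxy : x ≫ f.onRel = y ≫ g.onRel := by
    apply Z.rel_ext
    · rw [Category.assoc, Category.assoc, f.w₁, g.w₁, reassoc_of% hx₁, reassoc_of% hy₁,
        pullback.condition]
    · rw [Category.assoc, Category.assoc, f.w₂, g.w₂, reassoc_of% hx₂, reassoc_of% hy₂,
        pullback.condition]
  refine ⟨pullback.lift x y hxy, pullback.hom_ext ?_ ?_, pullback.hom_ext ?_ ?_⟩
  · rw [Category.assoc, pullbackR₁_fst, pullback.lift_fst_assoc, hx₁]
  · rw [Category.assoc, pullbackR₁_snd, pullback.lift_snd_assoc, hy₁]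
  · rw [Category.assoc, pullbackR₂_fst, pullback.lift_fst_assoc, hx₂]
  · rw [Category.assoc, pullbackR₂_snd, pullback.lift_snd_assoc, hy₂]

theorem le_of_pullbackRel_fst {T : C} (t : T ⟶ pullback f.onRel g.onRel) :
    X.Le ((t ≫ pullbackR₁ f g) ≫ pullback.fst _ _) ((t ≫ pullbackR₂ f g) ≫ pullback.fst _ _) :=
  ⟨t ≫ pullback.fst _ _, by simp [pullbackR₁_fst], by simp [pullbackR₂_fst]⟩

theorem le_of_pullbackRel_snd {T : C} (t : T ⟶ pullback f.onRel g.onRel) :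
    Y.Le ((t ≫ pullbackR₁ f g) ≫ pullback.snd _ _) ((t ≫ pullbackR₂ f g) ≫ pullback.snd _ _) :=
  ⟨t ≫ pullback.snd _ _, by simp [pullbackR₁_snd], by simp [pullbackR₂_snd]⟩

/-- The pullback of internal preorders, computed componentwise. -/
noncomputable def pullbackObj : PreOrd C where
  carrier := pullback f.base g.base
  rel := pullback f.onRel g.onRel
  r₁ := pullbackR₁ f g
  r₂ := pullbackR₂ f g
  refl' := by
    obtain ⟨r, hr₁, hr₂⟩ := exists_pullbackRel f g (Le.refl X (𝟙 _ ≫ pullback.fst _ _))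
      (Le.refl Y (𝟙 _ ≫ pullback.snd _ _))
    exact ⟨{ toJointlyMono₂ := jointlyMono_pullback f g, r := r, reflexivity₁ := hr₁,
             reflexivity₂ := hr₂ }⟩
  trans' := by
    have hc : pullback.fst (pullbackR₂ f g) (pullbackR₁ f g) ≫ pullbackR₂ f g =
      pullback.snd (pullbackR₂ f g) (pullbackR₁ f g) ≫ pullbackR₁ f g := pullback.condition
    have h₁ := le_of_pullbackRel_fst f g (pullback.fst (pullbackR₂ f g) (pullbackR₁ f g))
    have h₂ := le_of_pullbackRel_snd f g (pullback.fst (pullbackR₂ f g) (pullbackR₁ f g))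
    rw [hc] at h₁ h₂
    obtain ⟨t, ht₁, ht₂⟩ := exists_pullbackRel f g (h₁.trans (le_of_pullbackRel_fst f g _))
      (h₂.trans (le_of_pullbackRel_snd f g _))
    exact ⟨{ toJointlyMono₂ := jointlyMono_pullback f g, c := pullback.cone _ _,
             isLimit := pullback.isLimit _ _, t := t, transitivity₁ := ht₁,
             transitivity₂ := ht₂ }⟩

/-- First projection of the pullback of internal preorders. -/
noncomputable def pullbackFst : pullbackObj f g ⟶ X where
  base := pullback.fst _ _
  onRel := pullback.fst _ _
  w₁ := (pullbackR₁_fst f g).symm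
  w₂ := (pullbackR₂_fst f g).symm

/-- Second projection of the pullback of internal preorders. -/
noncomputable def pullbackSnd : pullbackObj f g ⟶ Y where
  base := pullback.snd _ _
  onRel := pullback.snd _ _
  w₁ := (pullbackR₁_snd f g).symm
  w₂ := (pullbackR₂_snd f g).symm

theorem pullbackObj_le {T : C} {a b : T ⟶ (pullbackObj f g).carrier}
    (h : X.Le (a ≫ (pullbackFst f g).base) (b ≫ (pullbackFst f g).base))
    (h' : Y.Le (a ≫ (pullbackSnd f g).base) (b ≫ (pullbackSnd f g).base)) :
    (pullbackObj f g).Le a b :=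
  exists_pullbackRel f g h h'

/-- Morphisms are determined by their base arrows, so the universal property reduces to that of the
carriers once the lift is seen to be monotone, which is checked on each component. -/
theorem isPullback_pullbackObj : IsPullback (pullbackFst f g) (pullbackSnd f g) f g := by
  refine ⟨⟨hom_ext pullback.condition⟩, ⟨PullbackCone.IsLimit.mk _
    (fun s => homOfLe (Y := pullbackObj f g)
      (pullback.lift s.fst.base s.snd.base (congrArg Hom.base s.condition)) ?_) ?_ ?_ ?_⟩⟩
  · refine pullbackObj_le f g ⟨s.fst.onRel, ?_, ?_⟩ ⟨s.snd.onRel, ?_, ?_⟩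
    · exact s.fst.w₁.trans ((congrArg _ (pullback.lift_fst _ _ _).symm).trans
        (Category.assoc _ _ _).symm)
    · exact s.fst.w₂.trans ((congrArg _ (pullback.lift_fst _ _ _).symm).trans
        (Category.assoc _ _ _).symm)
    · exact s.snd.w₁.trans ((congrArg _ (pullback.lift_snd _ _ _).symm).trans
        (Category.assoc _ _ _).symm)
    · exact s.snd.w₂.trans ((congrArg _ (pullback.lift_snd _ _ _).symm).trans
        (Category.assoc _ _ _).symm)
  · exact fun s => hom_ext (pullback.lift_fst _ _ _)
  · exact fun s => hom_ext (pullback.lift_snd _ _ _)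
  · exact fun s m h₁ h₂ => hom_ext (pullback.hom_ext
      ((congrArg Hom.base h₁).trans (pullback.lift_fst _ _ _).symm)
      ((congrArg Hom.base h₂).trans (pullback.lift_snd _ _ _).symm))

end

instance hasPullbacks : HasPullbacks (PreOrd C) :=
  have {X Y Z : PreOrd C} {f : X ⟶ Z} {g : Y ⟶ Z} : HasPullback f g :=
    (isPullback_pullbackObj f g).hasPullback
  hasPullbacks_of_hasLimit_cospan _

end Pullback

/-! ### Extension along order-reflecting regular epimorphisms. -/

section Descent

variable {C : Type u} [Category.{v} C] [BarrExact C]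

/-- Morphisms into an antisymmetric preorder extend uniquely along a regular epimorphism that
reflects the order. -/
theorem exists_extension {P Z Y : PreOrd C} (p : P ⟶ Z) [IsRegularEpi p.base]
    (hp : ∀ ⦃T : C⦄ (a b : T ⟶ P.carrier), Z.Le (a ≫ p.base) (b ≫ p.base) → P.Le a b)
    (hY : Y.IsAntisymmetric) (f : P ⟶ Y) : ∃ g : Z ⟶ Y, p ≫ g = f := by
  -- The parallel pair presenting `p.base` becomes equal, hence related both ways, in `Z`.
  -- Reflection carries this back to `P`, and antisymmetry of `Y` turns it into an equality.
  have hf : IsRegularEpi.left p.base ≫ f.base = IsRegularEpi.right p.base ≫ f.base := by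
    have hw := IsRegularEpi.w p.base
    refine hY.eq_of_le ((hp _ _ ?_).map f) ((hp _ _ ?_).map f) <;>
    · rw [hw]
      exact Le.refl _ _
  obtain ⟨g, hg⟩ : ∃ g : Z.carrier ⟶ Y.carrier, p.base ≫ g = f.base :=
    ⟨IsRegularEpi.desc p.base f.base hf, IsRegularEpi.fac _ _ _⟩
  have hle : Y.Le (Z.r₁ ≫ g) (Z.r₂ ≫ g) := by
    -- Monotonicity is local: two successive covers of `Z.rel` lift the endpoints of the universal
    -- related pair to `P`, where the order is reflected.
    let e₁ : pullback p.base Z.r₁ ⟶ Z.rel := pullback.snd _ _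
    let a : pullback p.base Z.r₁ ⟶ P.carrier := pullback.fst _ _
    have ha : a ≫ p.base = e₁ ≫ Z.r₁ := pullback.condition
    let e₂ : pullback p.base (e₁ ≫ Z.r₂) ⟶ pullback p.base Z.r₁ := pullback.snd _ _
    let b : pullback p.base (e₁ ≫ Z.r₂) ⟶ P.carrier := pullback.fst _ _
    have hb : b ≫ p.base = e₂ ≫ e₁ ≫ Z.r₂ := pullback.condition
    have h := (hp (e₂ ≫ a) b ⟨e₂ ≫ e₁, by simp [ha], by simp [hb]⟩).map f
    rw [← hg, Category.assoc, reassoc_of% ha, reassoc_of% hb] at h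
    exact (h.descend e₂).descend e₁
  exact ⟨homOfLe g hle, hom_ext hg⟩

end Descent

end PreOrd

/-! ### Morphisms inverted by the reflector. -/

namespace ParOrd

variable {C : Type u} [Category.{v} C] [BarrExact C]

/-- The reflector inverts every regular epimorphism that reflects the order. -/
theorem isIso_reflector_map {P Z : PreOrd C} (p : P ⟶ Z) [IsRegularEpi p.base]
    (hp : ∀ ⦃T : C⦄ (a b : T ⟶ P.carrier), Z.Le (a ≫ p.base) (b ≫ p.base) → P.Le a b) :
    IsIso ((reflector C).map p) := by
  let adj := reflectorAdj C
  obtain ⟨s, hs⟩ := PreOrd.exists_extension p hp ((reflector C).obj P).property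
    (adj.unit.app P)
  have : Epi p := PreOrd.epi_of_epi_base p
  -- The inverse is the transpose of the extension `s` of the unit at `P` along `p`. The second
  -- identity, once transposed, is tested after the epimorphism `p` and becomes naturality of the
  -- unit.
  refine ⟨(adj.homEquiv _ _).symm s, ?_, ?_⟩
  · rw [← adj.homEquiv_naturality_left_symm]
    apply (adj.homEquiv _ _).injective
    rw [Equiv.apply_symm_apply, adj.homEquiv_id]
    exact hs
  · rw [← adj.homEquiv_naturality_right_symm]
    apply (adj.homEquiv _ _).injective
    rw [Equiv.apply_symm_apply, adj.homEquiv_id, ← cancel_epi p]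
    have hs' : p ≫ s = adj.unit.app P := hs
    rw [reassoc_of% hs']
    exact (adj.unit.naturality p).symm

/-- The reflector inverts every pullback of a unit component. -/
theorem isIso_reflector_map_of_isPullback {X P Z : PreOrd C} {p₁ : P ⟶ X} {p₂ : P ⟶ Z}
    {f : Z ⟶ X.quot} (h : IsPullback p₁ p₂ X.quotHom f) : IsIso ((reflector C).map p₂) := by
  let q := PreOrd.pullbackSnd X.quotHom f
  have : IsRegularEpi q.base :=
    let g : Z.carrier ⟶ X.quotObj := f.base
    inferInstanceAs (IsRegularEpi (pullback.snd X.quotπ g))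
  have hq : IsIso ((reflector C).map q) := by
    refine isIso_reflector_map q fun T a b hab =>
      PreOrd.pullbackObj_le X.quotHom f ?_ hab
    have hc := congrArg PreOrd.Hom.base (PreOrd.isPullback_pullbackObj X.quotHom f).w
    -- In the pullback, the images under `f` of the `Z`-components are the classes of the
    -- `X`-components, so a relation in `Z` gives one in the quotient, which `le_of_quot` lifts to
    -- `X`.
    obtain ⟨t, ht₁, ht₂⟩ := hab.map f
    refine X.le_of_quot t ?_ ?_
    · exact ht₁.trans ((Category.assoc _ _ _).trans ((congrArg _ hc.symm).trans
        (Category.assoc _ _ _).symm))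
    · exact ht₂.trans ((Category.assoc _ _ _).trans ((congrArg _ hc.symm).trans
        (Category.assoc _ _ _).symm))
  -- An arbitrary pullback differs from the componentwise one by an isomorphism.
  rw [← h.isoIsPullback_hom_snd _ _ (PreOrd.isPullback_pullbackObj X.quotHom f),
    Functor.map_comp]
  infer_instance

variable (C)

noncomputable instance : Reflective (incl C) where
  L := reflector C
  adj := reflectorAdj C

end ParOrd

/-! ### Formal consequences for adjunctions with invertible counit. -/

section Galois

variable {B : Type u₁} [Category.{v₁} B] {A : Type u₂} [Category.{v₂} A]
  {F : B ⥤ A} {V : A ⥤ B}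

/-- For an adjunction with invertible counit, if the left adjoint inverts every pullback of a unit
component then it preserves these pullbacks. -/
theorem hasStableUnits_of_isIso_map (adj : F ⊣ V) [IsIso adj.counit]
    (h : ∀ ⦃X P Z : B⦄ (p₁ : P ⟶ X) (p₂ : P ⟶ Z) (f : Z ⟶ V.obj (F.obj X)),
      IsPullback p₁ p₂ (adj.unit.app X) f → IsIso (F.map p₂)) :
    HasStableUnits adj := by
  intro X P Z p₁ p₂ f hp
  have := h p₁ p₂ f hp
  -- By the triangle identity this is the inverse of the counit at `F.obj X`.
  have : IsIso (F.map (adj.unit.app X)) := by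
    rw [← IsIso.inv_eq_of_inv_hom_id (adj.left_triangle_components X)]
    infer_instance
  exact IsPullback.of_vert_isIso ⟨by rw [← F.map_comp, hp.w, F.map_comp]⟩

/-- For an adjunction with invertible counit, if the left adjoint inverts every pullback of a unit
component then the induced functors on slices are fully faithful. -/
theorem isAdmissibleGaloisStructure_of_isIso_map [HasPullbacks B] [HasPullbacks A] (adj : F ⊣ V)
    [IsIso adj.counit]
    (h : ∀ ⦃X P Z : B⦄ (p₁ : P ⟶ X) (p₂ : P ⟶ Z) (f : Z ⟶ V.obj (F.obj X)),
      IsPullback p₁ p₂ (adj.unit.app X) f → IsIso (F.map p₂)) :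
    IsAdmissibleGaloisStructure adj := by
  refine ⟨inferInstance, inferInstance, fun X => ?_⟩
  let adj' : _ ⊣ sliceRightAdjoint adj X :=
    (Over.mapPullbackAdj (adj.unit.app X)).comp (Over.postAdjunctionRight adj)
  have : IsIso adj'.counit := by
    rw [NatTrans.isIso_iff_isIso_app]
    intro Y
    have hY : (adj'.counit.app Y).left =
        F.map (pullback.fst (V.map Y.hom) (adj.unit.app X)) ≫ adj.counit.app Y.left := by
      simp [adj', sliceRightAdjoint]
      rfl
    -- This projection is the pullback of the unit along `V.map Y.hom`, hence inverted by `F`.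
    have hF := h _ _ _ (IsPullback.of_hasPullback (V.map Y.hom) (adj.unit.app X)).flip
    have : IsIso ((Over.forget _).map (adj'.counit.app Y)) := by
      change IsIso (adj'.counit.app Y).left
      rw [hY]
      exact IsIso.comp_isIso' hF inferInstance
    exact isIso_of_reflects_iso _ (Over.forget _)
  exact ⟨adj'.fullyFaithfulROfIsIsoCounit.full, adj'.fullyFaithfulROfIsIsoCounit.faithful⟩

end Galois

/-- For every exact category `C`, the reflector `F : PreOrd(C) ⥤ ParOrd(C)`, whose unit is the
canonical quotient `(π, π̄)` by `∼ρ = ρ ∧ ρ°`, has stable units, i.e. preserves every pullback along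
a component `(π, π̄)`; and it induces an admissible categorical Galois structure. -/
theorem mainTheorem1 (C : Type u) [Category.{v} C] [BarrExact C] :
    (∀ X : PreOrd C, (ParOrd.reflectorAdj C).unit.app X = X.quotHom) ∧
    HasStableUnits (ParOrd.reflectorAdj C) ∧
    IsAdmissibleGaloisStructure (ParOrd.reflectorAdj C) := by
  have h : ∀ ⦃X P Z : PreOrd C⦄ (p₁ : P ⟶ X) (p₂ : P ⟶ Z)
      (f : Z ⟶ (ParOrd.incl C).obj ((ParOrd.reflector C).obj X)),
      IsPullback p₁ p₂ ((ParOrd.reflectorAdj C).unit.app X) f →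
        IsIso ((ParOrd.reflector C).map p₂) := by
    intro X P Z p₁ p₂ f hp
    rw [ParOrd.reflectorAdj_unit_app] at hp
    exact ParOrd.isIso_reflector_map_of_isPullback hp
  -- A reflective subcategory inherits limits from the ambient category.
  have : HasPullbacks (ParOrd C) := hasLimitsOfShape_of_reflective (ParOrd.incl C)
  exact ⟨ParOrd.reflectorAdj_unit_app C, hasStableUnits_of_isIso_map _ h,
    isAdmissibleGaloisStructure_of_isIso_map _ h⟩
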